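/- For $0<\xi<\pi/4$ put $\alpha=e^{-i\xi}/(2\cos\xi)$, and let $f_1(z)=\alpha z$, $f_2(z)=-\overline{\alpha}z+1$ on $\mathbb{C}$ and $z_0=\alpha/(1-|\alpha|^4)$, which is the fixed point of $f_2\circ f_2\circ f_1\circ f_1$. Write $f_{a_1\cdots a_k}=f_{a_1}\circ\cdots\circ f_{a_k}$. For points $v_1,\dots,v_N$ which are the consecutive vertices, in clockwise order, of a convex polygon, let $\mathcal{P}(v_1,\dots,v_N)$ be the closed convex polygon with these vertices, that is, the intersection over $n$ (with $v_{N+1}=v_1$) of the closed half-planes to the left of the line directed from $v_{n+1}$ to $v_n$. Let $$A_1=\mathcal{P}\big(z_0,f_1(z_0),f_{112}(z_0),f_{12}(z_0)\big),\qquad A_m=f_1^{\,m-1}(A_1)\quad(m\in\mathbb{Z}),$$ let $B$ be the intersection of $A_0$ with the closed half-plane to the left of the line directed from $f_{221}(z_0)$ to $f_{212}(z_0)$, and let $$\mathcal{C}=\Big(\bigcup_{n=1}^{\infty}A_n\Big)\cup B\cup\Big(\bigcup_{n=1}^{\infty}f_2(A_n)\Big).$$ There is a root $x_0$ of $x^6-3x^4+2x^2-1=0$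 with $\sqrt2<x_0<(1+\sqrt5)/2$ such that $\xi_0=\arccos(x_0/2)$ satisfies $0<\xi_0<\pi/4$ and $|\xi_0-0.703858|<5\cdot10^{-7}$, and such that $f_1(\mathcal{C})\cap f_2(\mathcal{C})=\emptyset$ for every $\xi$ with $0<\xi<\xi_0$. Moreover, for every such $\xi$, $f_1(\mathcal{C})\cup f_2(\mathcal{C})\subset\mathcal{C}$, and the interior $U$ of $\mathcal{C}$ satisfies the open set condition for the iterated function system $\{f_1,f_2\}$: $U$ is a non-empty open set with $f_1(U)\cup f_2(U)\subset U$ and $f_1(U)\cap f_2(U)=\emptyset$. -/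

import Mathlib

namespace DragonCurve

noncomputable section

/-- The number `α = e^{-iξ} / (2 cos ξ)`. -/
def alpha (ξ : ℝ) : ℂ :=
  Complex.exp (-((ξ : ℂ) * Complex.I)) / ((2 * Real.cos ξ : ℝ) : ℂ)

/-- The map `f₁(z) = α z`. -/
def f₁ (ξ : ℝ) (z : ℂ) : ℂ := alpha ξ * z

/-- The map `f₂(z) = 1 - conj(α) z`. -/
def f₂ (ξ : ℝ) (z : ℂ) : ℂ := -(starRingEnd ℂ (alpha ξ)) * z + 1

/-- The point `z₀ = α / (1 - |α|⁴)`, the fixed point of `f₂ ∘ f₂ ∘ f₁ ∘ f₁`. -/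
def z₀ (ξ : ℝ) : ℂ := alpha ξ / ((1 - ‖alpha ξ‖ ^ 4 : ℝ) : ℂ)

/-- The oriented angle `∠(a, b, c)` at `b`, with values in `(-π, π]`. -/
def angle (a b c : ℂ) : ℝ := Complex.arg ((c - b) / (a - b))

/-- The open half-plane to the left of the line directed from `a` to `b` (for `a ≠ b`). -/
def leftHalfPlane (a b : ℂ) : Set ℂ :=
  {z | 0 < angle b a z ∧ angle b a z < Real.pi}

/-- The convex polygon whose vertices, listed clockwise, are `v 0, …, v (N - 1)`: the
intersection of the closed half-planes to the left of the lines directed from `v (n + 1)`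
to `v n`, the indices being taken modulo `N`. -/
def polygon {N : ℕ} [NeZero N] (v : Fin N → ℂ) : Set ℂ :=
  ⋂ n : Fin N, closure (leftHalfPlane (v (n + 1)) (v n))

/-- The `m`-th iterate of `f₁`, for an integer `m`; see `f₁Iter_natCast` and
`f₁Iter_neg_comp` below. -/
def f₁Iter (ξ : ℝ) (m : ℤ) (z : ℂ) : ℂ := alpha ξ ^ m * z

theorem f₁Iter_natCast (ξ : ℝ) (n : ℕ) : f₁Iter ξ (n : ℤ) = (f₁ ξ)^[n] := by
  induction n with
  | zero => funext z; simp [f₁Iter]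
  | succ k ih =>
    rw [Function.iterate_succ', ← ih]
    funext z
    simp only [f₁Iter, f₁, Function.comp_apply, zpow_natCast, pow_succ]
    ring

theorem f₁Iter_neg_comp (ξ : ℝ) (hξ : Real.cos ξ ≠ 0) (m : ℤ) (z : ℂ) :
    f₁Iter ξ (-m) (f₁Iter ξ m z) = z := by
  have h : alpha ξ ≠ 0 := by
    unfold alpha
    refine div_ne_zero (Complex.exp_ne_zero _) ?_
    exact_mod_cast mul_ne_zero two_ne_zero hξ
  simp only [f₁Iter, zpow_neg]
  exact inv_mul_cancel_left₀ (zpow_ne_zero m h) z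

/-- The quadrilateral `A₁` with vertices `z₀, f₁(z₀), f₁f₁f₂(z₀), f₁f₂(z₀)`. -/
def A₁ (ξ : ℝ) : Set ℂ :=
  polygon ![z₀ ξ, f₁ ξ (z₀ ξ), f₁ ξ (f₁ ξ (f₂ ξ (z₀ ξ))), f₁ ξ (f₂ ξ (z₀ ξ))]

/-- The quadrilateral `A_m = f₁^{m-1}(A₁)`, for an integer `m`. -/
def A (ξ : ℝ) (m : ℤ) : Set ℂ := f₁Iter ξ (m - 1) '' A₁ ξ

/-- The pentagon `B`: the quadrilateral `A₀` cut along the line through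
`f₂f₂f₁(z₀)` and `f₂f₁f₂(z₀)`. -/
def B (ξ : ℝ) : Set ℂ :=
  A ξ 0 ∩ closure (leftHalfPlane (f₂ ξ (f₂ ξ (f₁ ξ (z₀ ξ)))) (f₂ ξ (f₁ ξ (f₂ ξ (z₀ ξ)))))

/-- The infinite polygon `𝒞`. -/
def C (ξ : ℝ) : Set ℂ :=
  (⋃ (n : ℕ) (_ : 1 ≤ n), A ξ n) ∪ B ξ ∪ (⋃ (n : ℕ) (_ : 1 ≤ n), f₂ ξ '' A ξ n)

/-- The set `U` witnesses the open set condition for the iterated function system `{f, g}`. -/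
def OpenSetCondition (f g : ℂ → ℂ) (U : Set ℂ) : Prop :=
  IsOpen U ∧ U.Nonempty ∧ f '' U ∪ g '' U ⊆ U ∧ f '' U ∩ g '' U = ∅

end

end DragonCurve

/-! Put `r = |α|²`, `c = 1/(1 - r²)`, `k = 1 - r - r²`. Since `α² = α - r`, in coordinates `(o, a)`
for the real basis `1, α` multiplication by `α` is `(o, a) ↦ (-ra, o + a)` and `f₂` is `(o, a) ↦ (1
- o - ra, o)`. Then `A₀` is `o, a ≥ 0`, `kc ≤ o + a ≤ c`, and `B` adds the cut `o + (1 - r)a ≤ 1 -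
rkc`.

For `w ∈ A₀` the point `αⁿ⁺¹w` is `(-r b n, b (n+1))` with `b (n+2) = b (n+1) - r b n`. Everything
about the infinite spirals thus reduces to bounds on one recurrence: `-rc ≤ b n ≤ c` (`bounds`), `b
n < kc` for `n ≥ 4` (`lt_of_four_le`), and `b n > -rkc` (`neg_lt`). The last is where the critical
value arises: near it the extreme case is `b 5` with `b 0 = b 1 = c`, the orbit of `z₀`, which needs
`1 - 3r + 2r² - r³ > 0`. With `r = 1/x²` this is the sextic in `x`.

Invariance of `C` is a check on its three kinds of pieces. Disjointness has nine cases. Most are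
separated by a linear functional; the spirals around `α` need `neg_lt`. The open set condition
follows because both maps are homeomorphisms. -/

namespace DragonCurve

/-! ### Estimates for the linear recurrence -/

/-- A solution of the recurrence `b (n + 2) = b (n + 1) - r * b n` whose initial values describe
a point of the quadrilateral `A₀`. -/
structure SpiralSequence (r c : ℝ) (b : ℕ → ℝ) : Prop where
  recurrence : ∀ n, b (n + 2) = b (n + 1) - r * b n
  zero_nonneg : 0 ≤ b 0
  zero_le_one : b 0 ≤ b 1
  one_lower : (1 - r - r ^ 2) * c ≤ b 1
  one_upper : b 1 ≤ c

/-- The parameters `r = |α|²` below the critical value. -/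
structure Subcritical (r : ℝ) : Prop where
  quarter_lt : 1 / 4 < r
  cubic_pos : 0 < 1 - 3 * r + 2 * r ^ 2 - r ^ 3

/-- The cubic is decreasing, with root near 0.4302. This rational bound is what the polynomial
inequalities below use. -/
theorem Subcritical.lt {r : ℝ} (h : Subcritical r) : r < 431 / 1000 := by
  by_contra! hr
  nlinarith [h.cubic_pos, mul_nonneg (sub_nonneg.2 hr) (sq_nonneg (r - 1)),
    mul_nonneg (sub_nonneg.2 hr) (sq_nonneg r)]

namespace SpiralSequence

variable {r c : ℝ} {b : ℕ → ℝ}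

theorem bounds (hb : SpiralSequence r c b) (hr : 0 < r) (hr' : r < 1 / 2) (hc : 0 < c) (n : ℕ) :
    -(r * c) ≤ b n ∧ b n ≤ c := by
  have hrc : 0 < r * c := mul_pos hr hc
  suffices h : ∀ n, (-(r * c) ≤ b n ∧ b n ≤ c) ∧ (-(r * c) ≤ b (n + 1) ∧ b (n + 1) ≤ c) ∧
      (-(r * c) ≤ b (n + 2) ∧ b (n + 2) ≤ c) from (h n).1
  intro n
  induction n with
  | zero =>
    have h := hb.recurrence 0
    have h0 := hb.zero_nonneg
    have h1 := hb.zero_le_one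
    have h2 := hb.one_upper
    simp only [zero_add] at *
    refine ⟨⟨by linarith, by linarith⟩, ⟨by linarith, by linarith⟩, ?_, ?_⟩ <;> nlinarith
  | succ n ih =>
    obtain ⟨⟨h1, h2⟩, h3, h4⟩ := ih
    refine ⟨h3, h4, ?_⟩
    have e1 := hb.recurrence n
    have e2 := hb.recurrence (n + 1)
    simp only [add_assoc, Nat.reduceAdd] at *
    -- The new term is both `b (n+2) - r b (n+1)` and `(1-r) b (n+1) - r b n`. The sign of `b (n+1)`
    -- decides which form gives which bound.
    rcases le_total 0 (b (n + 1)) with h | h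
    · constructor
      · nlinarith
      · nlinarith
    · constructor
      · nlinarith
      · have : r * -(r * c) ≤ r * b n := mul_le_mul_of_nonneg_left h1 hr.le
        nlinarith

theorem sub_bounds (hb : SpiralSequence r c b) (hr : 0 < r) (hr' : r < 1 / 2) (hc : 0 < c)
    (n : ℕ) : -(r * c) ≤ b (n + 1) - b n ∧ b (n + 1) - b n ≤ c := by
  have hrc : 0 < r * c := mul_pos hr hc
  cases n with
  | zero =>
    have h0 := hb.zero_nonneg
    have h1 := hb.zero_le_one
    have h2 := hb.one_upper
    simp only [zero_add]
    constructor <;> linarith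
  | succ n =>
    have e := hb.recurrence n
    obtain ⟨hl, hu⟩ := hb.bounds hr hr' hc n
    simp only [add_assoc, Nat.reduceAdd]
    constructor <;> nlinarith

theorem initial_nonneg (hb : SpiralSequence r c b) (hr : Subcritical r) :
    0 ≤ b 2 ∧ 0 ≤ b 3 := by
  have h := hr.quarter_lt
  have h' := hr.lt
  have e1 := hb.recurrence 0
  have e2 := hb.recurrence 1
  have h0 := hb.zero_nonneg
  have h1 := hb.zero_le_one
  simp only [zero_add, Nat.reduceAdd] at *
  constructor <;> nlinarith

theorem lt_of_four_le (hb : SpiralSequence r c b) (hr : Subcritical r) (hc : 0 < c) {n : ℕ}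
    (hn : 4 ≤ n) : b n < (1 - r - r ^ 2) * c := by
  have h := hr.quarter_lt
  have h' := hr.lt
  obtain ⟨n, rfl⟩ := Nat.exists_eq_add_of_le' hn
  induction n with
  | zero =>
    have e1 := hb.recurrence 0
    have e2 := hb.recurrence 1
    have e3 := hb.recurrence 2
    have h0 := hb.zero_nonneg
    have h1 := hb.zero_le_one
    have h2 := hb.one_upper
    simp only [zero_add, Nat.reduceAdd] at *
    have : b 4 = b 1 - 2 * (r * b 1) - r * (1 - r) * b 0 := by rw [e3, e2, e1]; ring
    have : 0 ≤ r * (1 - r) * b 0 := mul_nonneg (by nlinarith) h0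
    have : (1 - 2 * r) * b 1 ≤ (1 - 2 * r) * c := mul_le_mul_of_nonneg_left h2 (by linarith)
    have : 0 < r * (1 - r) * c := mul_pos (by nlinarith) hc
    linarith
  | succ n ih =>
    have e1 := hb.recurrence (n + 2)
    have e2 := hb.recurrence (n + 3)
    have hl := (hb.bounds (by linarith) (by linarith) hc (n + 2)).1
    have hl' := (hb.bounds (by linarith) (by linarith) hc (n + 3)).1
    specialize ih (by omega)
    simp only [add_assoc, Nat.reduceAdd] at *
    rcases le_total 0 (b (n + 3)) with h3 | h3
    · nlinarith
    · have : r * -(r * c) ≤ r * b (n + 2) := mul_le_mul_of_nonneg_left hl (by linarith)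
      have : 0 < (1 - r - 2 * r ^ 2) * c := mul_pos (by nlinarith) hc
      nlinarith

/-- The first four terms are nonnegative, and `b 4` is bounded directly. After that a term can only
fall below its predecessor if the term before that is positive, and then it is expanded in earlier
terms, all at most `c`. -/
theorem neg_lt (hb : SpiralSequence r c b) (hr : Subcritical r) (hc : 0 < c) (n : ℕ) :
    -(r * ((1 - r - r ^ 2) * c)) < b n := by
  have h := hr.quarter_lt
  have h' := hr.lt
  have hcub := hr.cubic_pos
  have hk : 0 < r * ((1 - r - r ^ 2) * c) := by
    have : 0 < 1 - r - r ^ 2 := by nlinarith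
    positivity
  have hup := fun n => (hb.bounds (by linarith) (by linarith) hc n).2
  obtain ⟨h2, h3⟩ := hb.initial_nonneg hr
  have h0 := hb.zero_nonneg
  have h1 := hb.zero_le_one
  have h4 : -(r * ((1 - r - r ^ 2) * c)) < b 4 := by
    have e1 := hb.recurrence 0
    have e2 := hb.recurrence 1
    have e3 := hb.recurrence 2
    have hu := hb.one_upper
    simp only [zero_add, Nat.reduceAdd] at *
    have e : b 4 = (1 - 2 * r) * (b 1 - b 0) + (1 - 3 * r + r ^ 2) * b 0 := by
      rw [e3, e2, e1]; ring
    have : 0 ≤ (1 - 2 * r) * (b 1 - b 0) := mul_nonneg (by linarith) (by linarith)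
    rcases le_total 0 (1 - 3 * r + r ^ 2) with hp | hp
    · have := mul_nonneg hp h0
      linarith
    · have : (1 - 3 * r + r ^ 2) * c ≤ (1 - 3 * r + r ^ 2) * b 0 :=
        mul_le_mul_of_nonpos_left (h1.trans hu) hp
      have : 0 < (1 - 2 * r - r ^ 3) * c := mul_pos (by nlinarith) hc
      nlinarith
  have key : ∀ n, -(r * ((1 - r - r ^ 2) * c)) < b (n + 4) := by
    intro n
    induction n with
    | zero => exact h4
    | succ n ih =>
      have e1 := hb.recurrence n
      have e2 := hb.recurrence (n + 1)
      have e3 := hb.recurrence (n + 2)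
      have e4 := hb.recurrence (n + 3)
      have u0 := hup n
      have u1 := hup (n + 1)
      simp only [add_assoc, Nat.reduceAdd] at *
      rcases le_total (b (n + 3)) 0 with hn | hn
      · nlinarith
      -- The sign of this coefficient decides the expansion. If it is negative, putting `b n = b
      -- (n+1) = c` leaves `(1 - 4r + 3r²)c`, which exceeds `-rkc` exactly when the cubic is
      -- positive.
      · rcases le_total 0 (1 - 3 * r + r ^ 2) with hp | hp
        · have e : (1 - r) * b (n + 5) = (1 - 3 * r + r ^ 2) * b (n + 3) - r ^ 3 * b n := by
            rw [e4, e3, e2, e1]; ring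
          have := mul_nonneg hp hn
          have : r ^ 3 * b n ≤ r ^ 3 * c := mul_le_mul_of_nonneg_left u0 (by positivity)
          have : 0 < r * (1 - 2 * r - r ^ 2 + r ^ 3) * c :=
            mul_pos (mul_pos (by linarith) (by nlinarith)) hc
          have : 0 < (1 - r) * (b (n + 5) + r * ((1 - r - r ^ 2) * c)) := by nlinarith
          have := (mul_pos_iff_of_pos_left (by linarith)).1 this
          linarith
        · have e : b (n + 5) = (1 - 3 * r + r ^ 2) * b (n + 1) - r * (1 - 2 * r) * b n := by
            rw [e4, e3, e2, e1]; ring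
          have : (1 - 3 * r + r ^ 2) * c ≤ (1 - 3 * r + r ^ 2) * b (n + 1) :=
            mul_le_mul_of_nonpos_left u1 hp
          have : r * (1 - 2 * r) * b n ≤ r * (1 - 2 * r) * c :=
            mul_le_mul_of_nonneg_left u0 (mul_nonneg (by linarith) (by linarith))
          have := mul_pos hcub hc
          nlinarith
  match n with
  | 0 => linarith
  | 1 => linarith
  | 2 => linarith
  | 3 => linarith
  | n + 4 => exact key n

end SpiralSequence

/-! ### The critical parameter and its numerical value -/

theorem abs_cos_sub_taylor_le {x : ℝ} (hx : |x| ≤ 1) :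
    |Real.cos x - (1 - x ^ 2 / 2 + x ^ 4 / 24 - x ^ 6 / 720 + x ^ 8 / 40320)| ≤
      32 / 10 ^ 8 * |x| ^ 10 := by
  have h := Complex.exp_bound (x := (x : ℂ) * Complex.I) (by simpa using hx) (n := 10) (by norm_num)
  have h2 := (Complex.abs_re_le_norm _).trans h
  simp only [Complex.sub_re, Complex.exp_ofReal_mul_I_re] at h2
  have e : (∑ m ∈ Finset.range 10, ((x : ℂ) * Complex.I) ^ m / (m.factorial : ℂ)) =
      ((1 - x ^ 2 / 2 + x ^ 4 / 24 - x ^ 6 / 720 + x ^ 8 / 40320 : ℝ) : ℂ) +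
      ((x - x ^ 3 / 6 + x ^ 5 / 120 - x ^ 7 / 5040 + x ^ 9 / 362880 : ℝ) : ℂ) * Complex.I := by
    have i2 := Complex.I_sq
    have i3 : Complex.I ^ 3 = -Complex.I := by rw [pow_succ, i2]; ring
    have i4 : Complex.I ^ 4 = 1 := Complex.I_pow_four
    have i5 : Complex.I ^ 5 = Complex.I := by rw [pow_succ, i4]; ring
    have i6 : Complex.I ^ 6 = -1 := by rw [pow_succ, i5, ← i2]; ring
    have i7 : Complex.I ^ 7 = -Complex.I := by rw [pow_succ, i6]; ring
    have i8 : Complex.I ^ 8 = 1 := by rw [pow_succ, i7, neg_mul, ← pow_two, i2]; ring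
    have i9 : Complex.I ^ 9 = Complex.I := by rw [pow_succ, i8]; ring
    simp only [Finset.sum_range_succ, Finset.sum_range_zero, mul_pow, i2, i3, i4, i5, i6, i7, i8,
      i9, Nat.factorial]
    push_cast
    ring
  rw [e, Complex.add_re, Complex.ofReal_re, Complex.re_ofReal_mul, Complex.I_re, mul_zero,
    add_zero, norm_mul, Complex.norm_I, mul_one, Complex.norm_real, Real.norm_eq_abs] at h2
  refine h2.trans ?_
  rw [mul_comm]
  refine mul_le_mul_of_nonneg_right ?_ (by positivity)
  -- The remainder constant is `11 / (10! * 10)`, about `3.03e-7`.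
  norm_num [Nat.factorial]

theorem exists_critical_parameter :
    ∃ x₀ ξ₀ : ℝ,
      (√2 < x₀ ∧ x₀ < (1 + √5) / 2 ∧ x₀ ^ 6 - 3 * x₀ ^ 4 + 2 * x₀ ^ 2 - 1 = 0 ∧
        ξ₀ = Real.arccos (x₀ / 2)) ∧
      |ξ₀ - 0.703858| < 5 / 10 ^ 7 ∧ 0 < ξ₀ ∧ ξ₀ < Real.pi / 4 := by
  have hcont : ContinuousOn (fun x : ℝ => x ^ 6 - 3 * x ^ 4 + 2 * x ^ 2 - 1)
      (Set.Icc 1.5247025 1.5247026) := by fun_prop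
  obtain ⟨x, ⟨hx1, hx2⟩, hx⟩ := intermediate_value_Icc (by norm_num) hcont
    (show (0 : ℝ) ∈ Set.Icc _ _ by constructor <;> norm_num)
  have hs2 : √2 < x := by
    rw [Real.sqrt_lt' (by linarith)]
    nlinarith
  have hs5 : x < (1 + √5) / 2 := by
    have : (2.1 : ℝ) < √5 := by
      rw [Real.lt_sqrt (by norm_num)]
      norm_num
    linarith
  have hlow : 0.7038575 < Real.arccos (x / 2) := by
    have h := abs_le.1 (abs_cos_sub_taylor_le (x := 0.7038575) (by norm_num [abs_le]))
    rw [abs_of_pos (by norm_num)] at h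
    have h' : x / 2 < Real.cos 0.7038575 := by
      norm_num at h ⊢
      linarith [h.1]
    rw [← Real.arccos_cos (x := 0.7038575) (by norm_num) (by linarith [Real.pi_gt_three])]
    exact Real.arccos_lt_arccos (by linarith) h' (Real.cos_le_one _)
  have hup : Real.arccos (x / 2) < 0.7038585 := by
    have h := abs_le.1 (abs_cos_sub_taylor_le (x := 0.7038585) (by norm_num [abs_le]))
    rw [abs_of_pos (by norm_num)] at h
    have h' : Real.cos 0.7038585 < x / 2 := by
      norm_num at h ⊢
      linarith [h.2]
    rw [← Real.arccos_cos (x := 0.7038585) (by norm_num) (by linarith [Real.pi_gt_three])]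
    exact Real.arccos_lt_arccos (Real.neg_one_le_cos _) h' (by linarith)
  refine ⟨x, _, ⟨hs2, hs5, hx, rfl⟩, ?_, by linarith, by linarith [Real.pi_gt_three]⟩
  rw [abs_lt]
  constructor <;> linarith

theorem cos_pos_of_lt_pi_div_four {ξ : ℝ} (h0 : 0 < ξ) (h1 : ξ < Real.pi / 4) :
    0 < Real.cos ξ :=
  Real.cos_pos_of_mem_Ioo ⟨by linarith [Real.pi_pos], by linarith [Real.pi_pos]⟩

theorem subcritical_of_lt_arccos {x ξ : ℝ} (hx : √2 < x)
    (hx' : x ^ 6 - 3 * x ^ 4 + 2 * x ^ 2 - 1 = 0) (h0 : 0 < ξ) (h1 : ξ < Real.arccos (x / 2))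
    (h2 : ξ < Real.pi / 4) : Subcritical (1 / (4 * Real.cos ξ ^ 2)) := by
  have hc := cos_pos_of_lt_pi_div_four h0 h2
  have hx0 : 0 < x := (Real.sqrt_nonneg 2).trans_lt hx
  have hxx : 2 < x ^ 2 := (Real.sqrt_lt' hx0).1 hx
  have hc1 : Real.cos ξ < 1 := by
    rw [← Real.cos_zero]
    exact Real.cos_lt_cos_of_nonneg_of_le_pi le_rfl (by linarith [Real.pi_pos]) h0
  have hlt : x / 2 < Real.cos ξ := by
    by_contra! h
    have := Real.arccos_le_arccos h
    rw [Real.arccos_cos h0.le (by linarith [Real.pi_pos])] at this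
    linarith
  set y := 4 * Real.cos ξ ^ 2 with hy
  have hxy : x ^ 2 < y := by nlinarith
  have hy0 : 0 < y := by positivity
  refine ⟨?_, ?_⟩
  · rw [div_lt_div_iff₀ (by norm_num) hy0]
    nlinarith
  · have e : 1 - 3 * (1 / y) + 2 * (1 / y) ^ 2 - (1 / y) ^ 3 =
        (y ^ 3 - 3 * y ^ 2 + 2 * y - 1) / y ^ 3 := by
      field_simp
    rw [e]
    refine div_pos ?_ (by positivity)
    -- The cofactor is the divided difference of the cubic, arranged so that every term is positive
    -- once `y` and `x ^ 2` exceed 2. This is where `√2 < x` enters.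
    have hf : (y ^ 3 - 3 * y ^ 2 + 2 * y - 1) - ((x ^ 2) ^ 3 - 3 * (x ^ 2) ^ 2 + 2 * x ^ 2 - 1) =
        (y - x ^ 2) * (y * (y - 2) + x ^ 2 * (x ^ 2 - 2) + (y - 1) * (x ^ 2 - 1) + 1) := by ring
    have : 0 < (y - x ^ 2) *
        (y * (y - 2) + x ^ 2 * (x ^ 2 - 2) + (y - 1) * (x ^ 2 - 1) + 1) := by
      have h1 : 0 < y * (y - 2) := mul_pos hy0 (by linarith)
      have h2 : 0 < x ^ 2 * (x ^ 2 - 2) := mul_pos (by linarith) (by linarith)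
      have h3 : 0 < (y - 1) * (x ^ 2 - 1) := mul_pos (by linarith) (by linarith)
      exact mul_pos (by linarith) (by linarith)
    nlinarith

/-! ### Coordinates in the real basis `1, α` -/

noncomputable section

/-- The number `|α|²`. -/
def ratio (ξ : ℝ) : ℝ := 1 / (4 * Real.cos ξ ^ 2)

/-- The coefficient of `1` of a complex number in the real basis `1, α`. -/
def coordOne (ξ : ℝ) (z : ℂ) : ℝ := z.re - z.im / (2 * (alpha ξ).im)

/-- The coefficient of `α` of a complex number in the real basis `1, α`. -/
def coordAlpha (ξ : ℝ) (z : ℂ) : ℝ := z.im / (alpha ξ).im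

end

variable {ξ : ℝ}

theorem alpha_eq (ξ : ℝ) :
    alpha ξ = ((Real.cos ξ / (2 * Real.cos ξ) : ℝ) : ℂ) +
      ((-Real.sin ξ / (2 * Real.cos ξ) : ℝ) : ℂ) * Complex.I := by
  have : -((ξ : ℂ) * Complex.I) = ((-ξ : ℝ) : ℂ) * Complex.I := by push_cast; ring
  rw [alpha, this, Complex.exp_mul_I, ← Complex.ofReal_cos, ← Complex.ofReal_sin, Real.cos_neg,
    Real.sin_neg]
  push_cast
  ring

theorem alpha_re (h0 : 0 < ξ) (h1 : ξ < Real.pi / 4) : (alpha ξ).re = 1 / 2 := by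
  have := cos_pos_of_lt_pi_div_four h0 h1
  rw [alpha_eq, Complex.add_re, Complex.ofReal_re, Complex.re_ofReal_mul, Complex.I_re]
  field_simp
  simp

theorem alpha_im (ξ : ℝ) : (alpha ξ).im = -Real.sin ξ / (2 * Real.cos ξ) := by
  rw [alpha_eq, Complex.add_im, Complex.ofReal_im, Complex.im_ofReal_mul, Complex.I_im]
  ring

theorem alpha_im_neg (h0 : 0 < ξ) (h1 : ξ < Real.pi / 4) : (alpha ξ).im < 0 := by
  have := cos_pos_of_lt_pi_div_four h0 h1
  have := Real.sin_pos_of_pos_of_lt_pi h0 (by linarith [Real.pi_pos])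
  rw [alpha_im, neg_div]
  have : 0 < Real.sin ξ / (2 * Real.cos ξ) := by positivity
  linarith

theorem alpha_im_sq (h0 : 0 < ξ) (h1 : ξ < Real.pi / 4) :
    (alpha ξ).im ^ 2 = ratio ξ - 1 / 4 := by
  have := cos_pos_of_lt_pi_div_four h0 h1
  have hs := Real.sin_sq_add_cos_sq ξ
  rw [alpha_im, ratio]
  field_simp
  linarith

theorem norm_alpha_sq (h0 : 0 < ξ) (h1 : ξ < Real.pi / 4) : ‖alpha ξ‖ ^ 2 = ratio ξ := by
  rw [← Complex.normSq_eq_norm_sq, Complex.normSq_apply, alpha_re h0 h1, ← pow_two (alpha ξ).im,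
    alpha_im_sq h0 h1]
  ring

theorem alpha_ne_zero (h0 : 0 < ξ) (h1 : ξ < Real.pi / 4) : alpha ξ ≠ 0 := fun h => by
  have := alpha_im_neg h0 h1
  simp [h] at this

theorem star_alpha (h0 : 0 < ξ) (h1 : ξ < Real.pi / 4) :
    (starRingEnd ℂ) (alpha ξ) = 1 - alpha ξ := by
  apply Complex.ext
  · rw [Complex.conj_re, Complex.sub_re, Complex.one_re, alpha_re h0 h1]; norm_num
  · rw [Complex.conj_im, Complex.sub_im, Complex.one_im]; ring

theorem alpha_sq (h0 : 0 < ξ) (h1 : ξ < Real.pi / 4) :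
    alpha ξ ^ 2 = alpha ξ - (ratio ξ : ℂ) := by
  have := alpha_im_sq h0 h1
  apply Complex.ext
  · rw [pow_two, Complex.mul_re, Complex.sub_re, Complex.ofReal_re, alpha_re h0 h1]; nlinarith
  · rw [pow_two, Complex.mul_im, Complex.sub_im, Complex.ofReal_im, alpha_re h0 h1]; ring

theorem coordOne_add (z w : ℂ) : coordOne ξ (z + w) = coordOne ξ z + coordOne ξ w := by
  simp only [coordOne, Complex.add_re, Complex.add_im]; ring

theorem coordAlpha_add (z w : ℂ) : coordAlpha ξ (z + w) = coordAlpha ξ z + coordAlpha ξ w := by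
  simp only [coordAlpha, Complex.add_im]; ring

theorem coordOne_sub (z w : ℂ) : coordOne ξ (z - w) = coordOne ξ z - coordOne ξ w := by
  simp only [coordOne, Complex.sub_re, Complex.sub_im]; ring

theorem coordAlpha_sub (z w : ℂ) : coordAlpha ξ (z - w) = coordAlpha ξ z - coordAlpha ξ w := by
  simp only [coordAlpha, Complex.sub_im]; ring

theorem coordOne_ofReal_mul (a : ℝ) (z : ℂ) : coordOne ξ (a * z) = a * coordOne ξ z := by
  simp only [coordOne, Complex.re_ofReal_mul, Complex.im_ofReal_mul]; ring

theorem coordAlpha_ofReal_mul (a : ℝ) (z : ℂ) : coordAlpha ξ (a * z) = a * coordAlpha ξ z := by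
  simp only [coordAlpha, Complex.im_ofReal_mul]; ring

theorem coordOne_ofReal (a : ℝ) : coordOne ξ a = a := by simp [coordOne]

theorem coordAlpha_ofReal (a : ℝ) : coordAlpha ξ a = 0 := by simp [coordAlpha]

theorem continuous_coordOne : Continuous (coordOne ξ) := by
  unfold coordOne
  fun_prop

theorem continuous_coordAlpha : Continuous (coordAlpha ξ) := by
  unfold coordAlpha
  fun_prop

theorem coordOne_alpha (h0 : 0 < ξ) (h1 : ξ < Real.pi / 4) : coordOne ξ (alpha ξ) = 0 := by
  have := (alpha_im_neg h0 h1).ne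
  rw [coordOne, alpha_re h0 h1]
  field_simp
  norm_num

theorem coordAlpha_alpha (h0 : 0 < ξ) (h1 : ξ < Real.pi / 4) : coordAlpha ξ (alpha ξ) = 1 :=
  div_self (alpha_im_neg h0 h1).ne

theorem coordOne_alpha_mul (h0 : 0 < ξ) (h1 : ξ < Real.pi / 4) (z : ℂ) :
    coordOne ξ (alpha ξ * z) = -(ratio ξ * coordAlpha ξ z) := by
  have := (alpha_im_neg h0 h1).ne
  have e : ratio ξ = 1 / 4 + (alpha ξ).im ^ 2 := by rw [alpha_im_sq h0 h1]; ring
  rw [coordOne, coordAlpha, e, Complex.mul_re, Complex.mul_im, alpha_re h0 h1]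
  field_simp
  ring

theorem coordAlpha_alpha_mul (h0 : 0 < ξ) (h1 : ξ < Real.pi / 4) (z : ℂ) :
    coordAlpha ξ (alpha ξ * z) = coordOne ξ z + coordAlpha ξ z := by
  have := (alpha_im_neg h0 h1).ne
  rw [coordOne, coordAlpha, coordAlpha, Complex.mul_im, alpha_re h0 h1]
  field_simp
  ring

theorem coordOne_f₁ (h0 : 0 < ξ) (h1 : ξ < Real.pi / 4) (z : ℂ) :
    coordOne ξ (f₁ ξ z) = -(ratio ξ * coordAlpha ξ z) := coordOne_alpha_mul h0 h1 z

theorem coordAlpha_f₁ (h0 : 0 < ξ) (h1 : ξ < Real.pi / 4) (z : ℂ) :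
    coordAlpha ξ (f₁ ξ z) = coordOne ξ z + coordAlpha ξ z := coordAlpha_alpha_mul h0 h1 z

theorem f₂_eq (h0 : 0 < ξ) (h1 : ξ < Real.pi / 4) (z : ℂ) :
    f₂ ξ z = ((1 : ℝ) : ℂ) - z + alpha ξ * z := by
  rw [f₂, star_alpha h0 h1]; push_cast; ring

theorem coordOne_f₂ (h0 : 0 < ξ) (h1 : ξ < Real.pi / 4) (z : ℂ) :
    coordOne ξ (f₂ ξ z) = 1 - coordOne ξ z - ratio ξ * coordAlpha ξ z := by
  rw [f₂_eq h0 h1, coordOne_add, coordOne_sub, coordOne_ofReal, coordOne_alpha_mul h0 h1]; ring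

theorem coordAlpha_f₂ (h0 : 0 < ξ) (h1 : ξ < Real.pi / 4) (z : ℂ) :
    coordAlpha ξ (f₂ ξ z) = coordOne ξ z := by
  rw [f₂_eq h0 h1, coordAlpha_add, coordAlpha_sub, coordAlpha_ofReal, coordAlpha_alpha_mul h0 h1]
  ring

theorem z₀_eq (h0 : 0 < ξ) (h1 : ξ < Real.pi / 4) :
    z₀ ξ = ((1 / (1 - ratio ξ ^ 2) : ℝ) : ℂ) * alpha ξ := by
  have : ‖alpha ξ‖ ^ 4 = ratio ξ ^ 2 := by rw [← norm_alpha_sq h0 h1]; ring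
  rw [z₀, this]
  push_cast
  ring

theorem coordOne_z₀ (h0 : 0 < ξ) (h1 : ξ < Real.pi / 4) : coordOne ξ (z₀ ξ) = 0 := by
  rw [z₀_eq h0 h1, coordOne_ofReal_mul, coordOne_alpha h0 h1, mul_zero]

theorem coordAlpha_z₀ (h0 : 0 < ξ) (h1 : ξ < Real.pi / 4) :
    coordAlpha ξ (z₀ ξ) = 1 / (1 - ratio ξ ^ 2) := by
  rw [z₀_eq h0 h1, coordAlpha_ofReal_mul, coordAlpha_alpha h0 h1, mul_one]

/-! ### Half-planes and polygons in coordinates -/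

theorem leftHalfPlane_eq {a b : ℂ} :
    leftHalfPlane a b = {z | 0 < ((z - a) / (b - a)).im} := by
  ext z
  simp only [leftHalfPlane, angle, Set.mem_ofPred_eq, Complex.arg_lt_pi_iff]
  rw [lt_iff_le_and_ne, Complex.arg_nonneg_iff, ne_comm, Ne, Complex.arg_eq_zero_iff]
  constructor
  · rintro ⟨⟨h, h'⟩, h''⟩
    refine lt_of_le_of_ne h fun h2 => ?_
    rcases h'' with h3 | h3
    · exact h' ⟨h3, h2.symm⟩
    · exact h3 h2.symm
  · intro h
    exact ⟨⟨h.le, fun h2 => h.ne' h2.2⟩, Or.inr h.ne'⟩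

theorem mem_closure_leftHalfPlane_iff_im {a b : ℂ} (hab : a ≠ b) {z : ℂ} :
    z ∈ closure (leftHalfPlane a b) ↔ 0 ≤ ((z - a) / (b - a)).im := by
  have hba : (b - a)⁻¹ ≠ 0 := inv_ne_zero (sub_ne_zero.2 hab.symm)
  let e : ℂ ≃ₜ ℂ := (Homeomorph.subRight a).trans (Homeomorph.mulRight₀ _ hba)
  have he : leftHalfPlane a b = e ⁻¹' {w | 0 < w.im} := leftHalfPlane_eq
  rw [he, ← e.preimage_closure, Complex.closure_setOfPred_lt_im]
  rfl

theorem mem_closure_leftHalfPlane (h0 : 0 < ξ) (h1 : ξ < Real.pi / 4) {a b : ℂ} (hab : a ≠ b)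
    {z : ℂ} :
    z ∈ closure (leftHalfPlane a b) ↔
      (coordAlpha ξ z - coordAlpha ξ a) * (coordOne ξ b - coordOne ξ a) ≤
        (coordOne ξ z - coordOne ξ a) * (coordAlpha ξ b - coordAlpha ξ a) := by
  have hα := alpha_im_neg h0 h1
  have hn : 0 < Complex.normSq (b - a) := Complex.normSq_pos.2 (sub_ne_zero.2 hab.symm)
  -- The basis `1, α` is negatively oriented because `Im α < 0`, so this factor is positive and the
  -- determinant appears with reversed sign.
  have e : ((z - a) / (b - a)).im = -(alpha ξ).im / Complex.normSq (b - a) *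
      ((coordOne ξ z - coordOne ξ a) * (coordAlpha ξ b - coordAlpha ξ a) -
      (coordAlpha ξ z - coordAlpha ξ a) * (coordOne ξ b - coordOne ξ a)) := by
    rw [← coordOne_sub, ← coordAlpha_sub, ← coordOne_sub, ← coordAlpha_sub, Complex.div_im,
      coordOne, coordOne, coordAlpha, coordAlpha]
    have := hα.ne
    field_simp
    ring
  rw [mem_closure_leftHalfPlane_iff_im hab, e, mul_nonneg_iff_of_pos_left, sub_nonneg]
  exact div_pos (by linarith) hn

theorem le_iff_le_of_sub_eq_mul {a b u v d : ℝ} (hd : 0 < d) (h : a - b = d * (u - v)) :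
    b ≤ a ↔ v ≤ u := by
  rw [← sub_nonneg, h, mul_nonneg_iff_of_pos_left hd, sub_nonneg]

theorem mem_A₁ (h0 : 0 < ξ) (h1 : ξ < Real.pi / 4) (hr : Subcritical (ratio ξ)) {z : ℂ} :
    z ∈ A₁ ξ ↔ coordOne ξ z ≤ 0 ∧ 0 ≤ coordOne ξ z + ratio ξ * coordAlpha ξ z ∧
      (1 - ratio ξ - ratio ξ ^ 2) * (1 / (1 - ratio ξ ^ 2)) ≤ coordAlpha ξ z ∧
      coordAlpha ξ z ≤ 1 / (1 - ratio ξ ^ 2) := by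
  have hlo := hr.quarter_lt
  have hhi := hr.lt
  have hd : 0 < 1 - ratio ξ ^ 2 := by nlinarith
  have hcd : 1 / (1 - ratio ξ ^ 2) * (1 - ratio ξ ^ 2) = 1 := by field_simp
  have hc : 0 < 1 / (1 - ratio ξ ^ 2) := by positivity
  have o0 := coordOne_z₀ h0 h1
  have a0 := coordAlpha_z₀ h0 h1
  set r := ratio ξ with hrdef
  set c := 1 / (1 - r ^ 2) with hcdef
  have hk : 0 < 1 - r - r ^ 2 := by nlinarith
  have hrc : 0 < r * c := mul_pos (by linarith) hc
  have o1 : coordOne ξ (f₁ ξ (z₀ ξ)) = -(r * c) := by rw [coordOne_f₁ h0 h1, a0]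
  have a1 : coordAlpha ξ (f₁ ξ (z₀ ξ)) = c := by rw [coordAlpha_f₁ h0 h1, o0, a0]; ring
  have o2 : coordOne ξ (f₁ ξ (f₂ ξ (z₀ ξ))) = 0 := by
    rw [coordOne_f₁ h0 h1, coordAlpha_f₂ h0 h1, o0]; ring
  have a2 : coordAlpha ξ (f₁ ξ (f₂ ξ (z₀ ξ))) = (1 - r - r ^ 2) * c := by
    rw [coordAlpha_f₁ h0 h1, coordAlpha_f₂ h0 h1, coordOne_f₂ h0 h1, o0, a0]; linarith
  have o3 : coordOne ξ (f₁ ξ (f₁ ξ (f₂ ξ (z₀ ξ)))) = -(r * ((1 - r - r ^ 2) * c)) := by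
    rw [coordOne_f₁ h0 h1, a2]
  have a3 : coordAlpha ξ (f₁ ξ (f₁ ξ (f₂ ξ (z₀ ξ)))) = (1 - r - r ^ 2) * c := by
    rw [coordAlpha_f₁ h0 h1, o2, a2]; ring
  have hkc : 0 < (1 - r - r ^ 2) * c := mul_pos hk hc
  have hrkc : 0 < r * ((1 - r - r ^ 2) * c) := mul_pos (by linarith) hkc
  have hd1 : 0 < c - (1 - r - r ^ 2) * c := by nlinarith
  have hn0 : f₁ ξ (z₀ ξ) ≠ z₀ ξ := fun h => by rw [h, o0] at o1; linarith
  have hn1 : f₁ ξ (f₁ ξ (f₂ ξ (z₀ ξ))) ≠ f₁ ξ (z₀ ξ) := fun h => by rw [h, a1] at a3; linarith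
  have hn2 : f₁ ξ (f₂ ξ (z₀ ξ)) ≠ f₁ ξ (f₁ ξ (f₂ ξ (z₀ ξ))) := fun h => by
    rw [← h, o2] at o3; linarith
  have hn3 : z₀ ξ ≠ f₁ ξ (f₂ ξ (z₀ ξ)) := fun h => by rw [← h, a0] at a2; linarith
  simp only [A₁, polygon, Set.mem_iInter, Fin.forall_fin_succ, IsEmpty.forall_iff, and_true]
  simp only [Matrix.cons_val_zero, Matrix.cons_val_one, zero_add, Fin.succ_zero_eq_one,
    Fin.succ_one_eq_two, Fin.isValue, Fin.reduceAdd, Fin.reduceSucc, Matrix.cons_val]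
  rw [mem_closure_leftHalfPlane h0 h1 hn0, mem_closure_leftHalfPlane h0 h1 hn1,
    mem_closure_leftHalfPlane h0 h1 hn2, mem_closure_leftHalfPlane h0 h1 hn3,
    o0, a0, o1, a1, o2, a2, o3, a3]
  set k := 1 - r - r ^ 2
  set x := coordOne ξ z
  set y := coordAlpha ξ z
  have e0 : (y - c) * (0 - -(r * c)) ≤ (x - -(r * c)) * (c - c) ↔ y ≤ c :=
    le_iff_le_of_sub_eq_mul hrc (by ring)
  have e1 : (y - k * c) * (-(r * c) - -(r * (k * c))) ≤ (x - -(r * (k * c))) * (c - k * c) ↔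
      0 ≤ x + r * y :=
    le_iff_le_of_sub_eq_mul hd1 (by ring)
  have e2 : (y - k * c) * (-(r * (k * c)) - 0) ≤ (x - 0) * (k * c - k * c) ↔ k * c ≤ y :=
    le_iff_le_of_sub_eq_mul hrkc (by ring)
  have e3 : (y - c) * (0 - 0) ≤ (x - 0) * (k * c - c) ↔ x ≤ 0 :=
    le_iff_le_of_sub_eq_mul hd1 (by ring)
  rw [e0, e1, e2, e3]
  tauto

theorem A_one : A ξ 1 = A₁ ξ := by
  have : f₁Iter ξ (1 - 1) = id := by
    funext z
    simp [f₁Iter]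
  rw [A, this, Set.image_id]

theorem mem_A_zero_iff (h0 : 0 < ξ) (h1 : ξ < Real.pi / 4) {z : ℂ} :
    z ∈ A ξ 0 ↔ alpha ξ * z ∈ A₁ ξ := by
  have hα := alpha_ne_zero h0 h1
  constructor
  · rintro ⟨w, hw, rfl⟩
    simpa [f₁Iter, hα] using hw
  · intro h
    exact ⟨_, h, by simp [f₁Iter, hα]⟩

theorem mem_A_natCast (h0 : 0 < ξ) (h1 : ξ < Real.pi / 4) {n : ℕ} {z : ℂ} :
    z ∈ A ξ n ↔ ∃ w ∈ A ξ 0, z = alpha ξ ^ n * w := by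
  have hα := alpha_ne_zero h0 h1
  constructor
  · rintro ⟨w, hw, rfl⟩
    refine ⟨(alpha ξ)⁻¹ * w, ?_, ?_⟩
    · rw [mem_A_zero_iff h0 h1, mul_inv_cancel_left₀ hα]
      exact hw
    · rw [f₁Iter, zpow_sub_one₀ hα, zpow_natCast, mul_assoc]
  · rintro ⟨w, hw, rfl⟩
    rw [mem_A_zero_iff h0 h1] at hw
    refine ⟨_, hw, ?_⟩
    rw [f₁Iter, zpow_sub_one₀ hα, zpow_natCast, mul_assoc, inv_mul_cancel_left₀ hα]

theorem mem_A_zero (h0 : 0 < ξ) (h1 : ξ < Real.pi / 4) (hr : Subcritical (ratio ξ)) {z : ℂ} :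
    z ∈ A ξ 0 ↔ 0 ≤ coordOne ξ z ∧ 0 ≤ coordAlpha ξ z ∧
      (1 - ratio ξ - ratio ξ ^ 2) * (1 / (1 - ratio ξ ^ 2)) ≤ coordOne ξ z + coordAlpha ξ z ∧
      coordOne ξ z + coordAlpha ξ z ≤ 1 / (1 - ratio ξ ^ 2) := by
  have hpos : 0 < ratio ξ := by linarith [hr.quarter_lt]
  rw [mem_A_zero_iff h0 h1, mem_A₁ h0 h1 hr, coordOne_alpha_mul h0 h1, coordAlpha_alpha_mul h0 h1,
    le_iff_le_of_sub_eq_mul (a := 0) (b := -(ratio ξ * coordAlpha ξ z)) (u := coordAlpha ξ z)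
      (v := 0) hpos (by ring),
    le_iff_le_of_sub_eq_mul (a := -(ratio ξ * coordAlpha ξ z) +
      ratio ξ * (coordOne ξ z + coordAlpha ξ z)) (b := 0) (u := coordOne ξ z) (v := 0) hpos
      (by ring)]
  tauto

theorem mem_B (h0 : 0 < ξ) (h1 : ξ < Real.pi / 4) (hr : Subcritical (ratio ξ)) {z : ℂ} :
    z ∈ B ξ ↔ z ∈ A ξ 0 ∧ coordOne ξ z + (1 - ratio ξ) * coordAlpha ξ z ≤
      1 - ratio ξ * ((1 - ratio ξ - ratio ξ ^ 2) * (1 / (1 - ratio ξ ^ 2))) := by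
  have hlo := hr.quarter_lt
  have hhi := hr.lt
  have hd : 0 < 1 - ratio ξ ^ 2 := by nlinarith
  have hcd : 1 / (1 - ratio ξ ^ 2) * (1 - ratio ξ ^ 2) = 1 := by field_simp
  have o0 := coordOne_z₀ h0 h1
  have a0 := coordAlpha_z₀ h0 h1
  set r := ratio ξ
  set c := 1 / (1 - r ^ 2)
  have o1 : coordOne ξ (f₂ ξ (f₂ ξ (f₁ ξ (z₀ ξ)))) = r ^ 2 * c := by
    simp only [coordOne_f₂ h0 h1, coordAlpha_f₂ h0 h1, coordOne_f₁ h0 h1, coordAlpha_f₁ h0 h1, o0,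
      a0]
    ring
  have a1 : coordAlpha ξ (f₂ ξ (f₂ ξ (f₁ ξ (z₀ ξ)))) = 1 := by
    simp only [coordOne_f₂ h0 h1, coordAlpha_f₂ h0 h1, coordOne_f₁ h0 h1, coordAlpha_f₁ h0 h1, o0,
      a0]
    ring
  have o2 : coordOne ξ (f₂ ξ (f₁ ξ (f₂ ξ (z₀ ξ)))) = 1 - r * ((1 - r - r ^ 2) * c) := by
    simp only [coordOne_f₂ h0 h1, coordAlpha_f₂ h0 h1, coordOne_f₁ h0 h1, coordAlpha_f₁ h0 h1, o0,
      a0]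
    linear_combination r * hcd
  have a2 : coordAlpha ξ (f₂ ξ (f₁ ξ (f₂ ξ (z₀ ξ)))) = 0 := by
    simp only [coordAlpha_f₂ h0 h1, coordOne_f₁ h0 h1, o0]
    ring
  have hne : f₂ ξ (f₂ ξ (f₁ ξ (z₀ ξ))) ≠ f₂ ξ (f₁ ξ (f₂ ξ (z₀ ξ))) := fun h => by
    rw [h, a2] at a1
    exact zero_ne_one a1
  rw [B, Set.mem_inter_iff, mem_closure_leftHalfPlane h0 h1 hne, o1, a1, o2, a2]
  refine and_congr_right fun _ => ?_
  refine le_iff_le_of_sub_eq_mul one_pos ?_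
  linear_combination (r * coordAlpha ξ z) * hcd

theorem mem_C {z : ℂ} (h0 : 0 < ξ) (h1 : ξ < Real.pi / 4) :
    z ∈ C ξ ↔ (∃ n : ℕ, ∃ w ∈ A ξ 0, z = alpha ξ ^ (n + 1) * w) ∨ z ∈ B ξ ∨
      ∃ n : ℕ, ∃ w ∈ A ξ 0, z = f₂ ξ (alpha ξ ^ (n + 1) * w) := by
  have hA : ∀ y, (∃ n : ℕ, 1 ≤ n ∧ y ∈ A ξ n) ↔
      ∃ n : ℕ, ∃ w ∈ A ξ 0, y = alpha ξ ^ (n + 1) * w := by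
    intro y
    constructor
    · rintro ⟨n, hn, hy⟩
      obtain ⟨n, rfl⟩ := Nat.exists_eq_add_of_le' hn
      exact ⟨n, (mem_A_natCast h0 h1).1 hy⟩
    · rintro ⟨n, hy⟩
      exact ⟨n + 1, by omega, (mem_A_natCast h0 h1).2 hy⟩
  have h2 : (∃ n : ℕ, 1 ≤ n ∧ z ∈ f₂ ξ '' A ξ n) ↔
      ∃ n : ℕ, ∃ w ∈ A ξ 0, z = f₂ ξ (alpha ξ ^ (n + 1) * w) := by
    constructor
    · rintro ⟨n, hn, y, hy, rfl⟩
      obtain ⟨m, w, hw, rfl⟩ := (hA y).1 ⟨n, hn, hy⟩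
      exact ⟨m, w, hw, rfl⟩
    · rintro ⟨m, w, hw, rfl⟩
      obtain ⟨n, hn, hy⟩ := (hA _).2 ⟨m, w, hw, rfl⟩
      exact ⟨n, hn, _, hy, rfl⟩
  simp only [C, Set.mem_union, Set.mem_iUnion, exists_prop, hA, h2, or_assoc]

/-! ### Invariance of `C` under both maps -/

theorem spiralSequence_of_mem (h0 : 0 < ξ) (h1 : ξ < Real.pi / 4) (hr : Subcritical (ratio ξ))
    {w : ℂ} (hw : w ∈ A ξ 0) :
    SpiralSequence (ratio ξ) (1 / (1 - ratio ξ ^ 2)) fun n => coordAlpha ξ (alpha ξ ^ n * w) := by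
  obtain ⟨ho, ha, hl, hu⟩ := (mem_A_zero h0 h1 hr).1 hw
  refine ⟨fun n => ?_, ?_, ?_, ?_, ?_⟩
  · simp only [pow_succ', mul_assoc, coordAlpha_alpha_mul h0 h1, coordOne_alpha_mul h0 h1]
    ring
  all_goals
    simp only [pow_zero, pow_one, one_mul, coordAlpha_alpha_mul h0 h1]
    linarith

theorem coordOne_pow_succ_mul (h0 : 0 < ξ) (h1 : ξ < Real.pi / 4) (n : ℕ) (w : ℂ) :
    coordOne ξ (alpha ξ ^ (n + 1) * w) = -(ratio ξ * coordAlpha ξ (alpha ξ ^ n * w)) := by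
  rw [pow_succ', mul_assoc, coordOne_alpha_mul h0 h1]

/-- A membership criterion for points near `α`, the common endpoint of two spirals. -/
theorem mem_C_of_coord (h0 : 0 < ξ) (h1 : ξ < Real.pi / 4) (hr : Subcritical (ratio ξ)) {z : ℂ}
    (hneg : coordOne ξ z ≤ 0 → 0 ≤ coordOne ξ z + ratio ξ * coordAlpha ξ z ∧
      (1 - ratio ξ - ratio ξ ^ 2) * (1 / (1 - ratio ξ ^ 2)) ≤ coordAlpha ξ z ∧
      coordAlpha ξ z ≤ 1 / (1 - ratio ξ ^ 2))
    (hpos : 0 ≤ coordOne ξ z → 0 ≤ coordAlpha ξ z ∧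
      (1 - ratio ξ - ratio ξ ^ 2) * (1 / (1 - ratio ξ ^ 2)) ≤ coordOne ξ z + coordAlpha ξ z ∧
      coordOne ξ z + coordAlpha ξ z ≤ 1 / (1 - ratio ξ ^ 2) ∧
      coordOne ξ z + (1 - ratio ξ) * coordAlpha ξ z ≤
        1 - ratio ξ * ((1 - ratio ξ - ratio ξ ^ 2) * (1 / (1 - ratio ξ ^ 2)))) : z ∈ C ξ := by
  rw [mem_C h0 h1]
  rcases le_total (coordOne ξ z) 0 with h | h
  · left
    have : z ∈ A ξ (1 : ℕ) := by
      rw [Nat.cast_one, A_one, mem_A₁ h0 h1 hr]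
      exact ⟨h, hneg h⟩
    exact ⟨0, (mem_A_natCast h0 h1).1 this⟩
  · right; left
    obtain ⟨ha, hb, hc, hd⟩ := hpos h
    rw [mem_B h0 h1 hr, mem_A_zero h0 h1 hr]
    exact ⟨⟨h, ha, hb, hc⟩, hd⟩

/-- Three of the six images are pieces of `C` or lie in `A₁`, and `f₂` maps `B` into itself. The
other two, `f₁f₂` and `f₂f₂` of the spiral around `0`, wind around `α` and fit into `A₁ ∪ B` by the
bounds on the recurrence. -/
theorem f₁_image_union_f₂_image_subset (h0 : 0 < ξ) (h1 : ξ < Real.pi / 4)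
    (hr : Subcritical (ratio ξ)) : f₁ ξ '' C ξ ∪ f₂ ξ '' C ξ ⊆ C ξ := by
  have hlo := hr.quarter_lt
  have hhi := hr.lt
  have hd : 0 < 1 - ratio ξ ^ 2 := by nlinarith
  have hcd : 1 / (1 - ratio ξ ^ 2) * (1 - ratio ξ ^ 2) = 1 := by field_simp
  have hc : 0 < 1 / (1 - ratio ξ ^ 2) := by positivity
  rintro _ (⟨z, hz, rfl⟩ | ⟨z, hz, rfl⟩)
  · rcases (mem_C h0 h1).1 hz with ⟨n, w, hw, rfl⟩ | hB | ⟨n, w, hw, rfl⟩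
    · refine (mem_C h0 h1).2 (Or.inl ⟨n + 1, w, hw, ?_⟩)
      rw [f₁, ← mul_assoc, ← pow_succ']
    · exact (mem_C h0 h1).2 (Or.inl ⟨0, z, hB.1, by rw [f₁, zero_add, pow_one]⟩)
    · have hs := spiralSequence_of_mem h0 h1 hr hw
      have hb := hs.bounds (by linarith) (by linarith) hc
      obtain ⟨x0, x0'⟩ := hb n
      obtain ⟨x1, x1'⟩ := hb (n + 1)
      obtain ⟨x2, x2'⟩ := hb (n + 2)
      have x3 := (hb (n + 3)).1
      have e0 := hs.recurrence n
      have e1 := hs.recurrence (n + 1)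
      apply mem_C_of_coord h0 h1 hr <;>
        rw [coordOne_f₁ h0 h1, coordAlpha_f₁ h0 h1, coordOne_f₂ h0 h1, coordAlpha_f₂ h0 h1,
          coordOne_pow_succ_mul h0 h1] <;>
        simp only [add_assoc, Nat.reduceAdd] at * <;>
        generalize 1 / (1 - ratio ξ ^ 2) = c at * <;>
        generalize coordAlpha ξ (alpha ξ ^ n * w) = b0 at * <;>
        generalize coordAlpha ξ (alpha ξ ^ (n + 1) * w) = b1 at * <;>
        generalize coordAlpha ξ (alpha ξ ^ (n + 2) * w) = b2 at * <;>
        generalize coordAlpha ξ (alpha ξ ^ (n + 3) * w) = b3 at * <;>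
        generalize ratio ξ = r at * <;>
        (have hr0 : 0 ≤ r := by linarith) <;>
        (have y0 := mul_nonneg hr0 (sub_nonneg.2 x0)) <;>
        (have y1 := mul_nonneg hr0 (sub_nonneg.2 x1)) <;>
        (have y1' := mul_nonneg hr0 (sub_nonneg.2 x1')) <;>
        (have y2 := mul_nonneg hr0 (sub_nonneg.2 x2)) <;>
        (have y2' := mul_nonneg hr0 (sub_nonneg.2 x2')) <;>
        (have y3 := mul_nonneg hr0 (sub_nonneg.2 x3)) <;>
        (have hF : 0 < c * (1 - 2 * r ^ 2 - r) := mul_pos hc (by nlinarith)) <;>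
        intro h
      · refine ⟨?_, by linarith, by linarith⟩
        have : 0 ≤ r * (1 + r * b0 - r * b1) := mul_nonneg hr0 (by linarith)
        linarith
      · have : 0 ≤ r ^ 2 * c := by positivity
        have hk : r * ((1 - r - r ^ 2) * c) = r - r ^ 2 * c := by linear_combination r * hcd
        subst e0
        subst e1
        refine ⟨?_, ?_, ?_, ?_⟩ <;> linarith
  · rcases (mem_C h0 h1).1 hz with ⟨n, w, hw, rfl⟩ | hB | ⟨n, w, hw, rfl⟩
    · exact (mem_C h0 h1).2 (Or.inr (Or.inr ⟨n, w, hw, rfl⟩))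
    · obtain ⟨hA, hcut⟩ := (mem_B h0 h1 hr).1 hB
      obtain ⟨ho, ha, hl, hu⟩ := (mem_A_zero h0 h1 hr).1 hA
      refine (mem_C h0 h1).2 (Or.inr (Or.inl ?_))
      rw [mem_B h0 h1 hr, mem_A_zero h0 h1 hr, coordOne_f₂ h0 h1, coordAlpha_f₂ h0 h1]
      generalize 1 / (1 - ratio ξ ^ 2) = c at *
      generalize coordOne ξ z = x at *
      generalize coordAlpha ξ z = y at *
      generalize ratio ξ = r at *
      have hr0 : 0 ≤ r := by linarith
      have h2 : 0 ≤ (1 - 2 * r) * y := mul_nonneg (by linarith) ha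
      have h3 : 0 ≤ r * ((1 - r - r ^ 2) * c) :=
        mul_nonneg hr0 (mul_nonneg (by nlinarith) hc.le)
      have h4 : 0 ≤ r * (c - (x + y)) := mul_nonneg hr0 (by linarith)
      have h5 : 0 ≤ r * ((x + y) - (1 - r - r ^ 2) * c) := mul_nonneg hr0 (by linarith)
      have h6 : 0 ≤ r * x := mul_nonneg hr0 ho
      have h7 : 0 ≤ r * y := mul_nonneg hr0 ha
      have h8 : 0 ≤ r ^ 2 * c := by positivity
      refine ⟨⟨?_, ?_, ?_, ?_⟩, ?_⟩ <;> linarith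
    · have hs := spiralSequence_of_mem h0 h1 hr hw
      have hb := hs.bounds (by linarith) (by linarith) hc
      obtain ⟨x0, x0'⟩ := hb n
      have x1' := (hb (n + 1)).2
      obtain ⟨d, d'⟩ := hs.sub_bounds (by linarith) (by linarith) hc n
      apply mem_C_of_coord h0 h1 hr <;>
        simp only [coordOne_f₂ h0 h1, coordAlpha_f₂ h0 h1, coordOne_pow_succ_mul h0 h1] <;>
        generalize 1 / (1 - ratio ξ ^ 2) = c at * <;>
        generalize coordAlpha ξ (alpha ξ ^ n * w) = b0 at * <;>
        generalize coordAlpha ξ (alpha ξ ^ (n + 1) * w) = b1 at * <;>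
        generalize ratio ξ = r at * <;>
        (have hr0 : 0 ≤ r := by linarith) <;>
        (have hrc : 0 ≤ c * r * (1 - r) := by
          have : 0 ≤ 1 - r := by linarith
          positivity) <;>
        (have hrc' : 0 < c * (1 - r ^ 2 - r) := mul_pos hc (by nlinarith)) <;>
        (have y0 := mul_nonneg hr0 (sub_nonneg.2 x0)) <;>
        (have y0' := mul_nonneg hr0 (mul_nonneg hr0 (sub_nonneg.2 x0'))) <;>
        (have y1' := mul_nonneg hr0 (mul_nonneg hr0 (sub_nonneg.2 x1'))) <;>
        (have z0 := mul_nonneg hr0 y0) <;>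
        (have z1 := mul_nonneg hr0 (sub_nonneg.2 d)) <;>
        (have z1' := mul_nonneg hr0 (sub_nonneg.2 d')) <;>
        intro h
      · refine ⟨?_, by linarith, by linarith⟩
        have : 0 ≤ (1 - r) * (b1 - b0 + r * c) := mul_nonneg (by linarith) (by linarith)
        have : 0 ≤ r * (1 + (1 - r) * (b1 - b0) + r * b0) := mul_nonneg hr0 (by linarith)
        linarith
      · have : 0 ≤ c * r * (1 - r) * (1 + r) := mul_nonneg hrc (by linarith)
        have hk : r * ((1 - r - r ^ 2) * c) = r - r ^ 2 * c := by linear_combination r * hcd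
        refine ⟨?_, ?_, ?_, ?_⟩ <;> linarith

/-! ### Disjointness of the two images -/

theorem f₁_image_inter_f₂_image_eq_empty (h0 : 0 < ξ) (h1 : ξ < Real.pi / 4)
    (hr : Subcritical (ratio ξ)) : f₁ ξ '' C ξ ∩ f₂ ξ '' C ξ = ∅ := by
  have hlo := hr.quarter_lt
  have hhi := hr.lt
  have hr0 : 0 ≤ ratio ξ := by linarith
  have hd : 0 < 1 - ratio ξ ^ 2 := by nlinarith
  have hcd : 1 / (1 - ratio ξ ^ 2) * (1 - ratio ξ ^ 2) = 1 := by field_simp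
  have hc : 0 < 1 / (1 - ratio ξ ^ 2) := by positivity
  -- The gap `kc - r²c`: `coordOne` is at most `r²c` on `f₁(C)`, and at least `1 - rc = kc` on `f₂`
  -- of the spiral around `0`.
  have hsep : 0 < 1 / (1 - ratio ξ ^ 2) * (1 - 2 * ratio ξ ^ 2 - ratio ξ) :=
    mul_pos hc (by nlinarith)
  have hkc : 0 < (1 - ratio ξ - ratio ξ ^ 2) * (1 / (1 - ratio ξ ^ 2)) :=
    mul_pos (by nlinarith) hc
  have hrkc : 0 < ratio ξ * ((1 - ratio ξ - ratio ξ ^ 2) * (1 / (1 - ratio ξ ^ 2))) :=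
    mul_pos (by linarith) hkc
  rw [← Set.disjoint_iff_inter_eq_empty, Set.disjoint_left]
  rintro _ ⟨u, hu, rfl⟩ ⟨v, hv, huv⟩
  have ho : coordOne ξ (f₂ ξ v) = coordOne ξ (f₁ ξ u) := by rw [huv]
  have ha : coordAlpha ξ (f₂ ξ v) = coordAlpha ξ (f₁ ξ u) := by rw [huv]
  rw [coordOne_f₂ h0 h1, coordOne_f₁ h0 h1] at ho
  rw [coordAlpha_f₂ h0 h1, coordAlpha_f₁ h0 h1] at ha
  rw [mem_C h0 h1] at hu hv
  have hbounds : ∀ w ∈ A ξ 0, ∀ n, -(ratio ξ * (1 / (1 - ratio ξ ^ 2))) ≤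
      coordAlpha ξ (alpha ξ ^ n * w) ∧ coordAlpha ξ (alpha ξ ^ n * w) ≤ 1 / (1 - ratio ξ ^ 2) :=
    fun w hw n => (spiralSequence_of_mem h0 h1 hr hw).bounds (by linarith) (by linarith) hc n
  have hfour : ∀ w ∈ A ξ 0, ∀ n, 4 ≤ n → coordAlpha ξ (alpha ξ ^ n * w) <
      (1 - ratio ξ - ratio ξ ^ 2) * (1 / (1 - ratio ξ ^ 2)) :=
    fun w hw n => (spiralSequence_of_mem h0 h1 hr hw).lt_of_four_le hr hc
  have hlower : ∀ w ∈ A ξ 0, ∀ n, -(ratio ξ * ((1 - ratio ξ - ratio ξ ^ 2) *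
      (1 / (1 - ratio ξ ^ 2)))) < coordAlpha ξ (alpha ξ ^ n * w) :=
    fun w hw n => (spiralSequence_of_mem h0 h1 hr hw).neg_lt hr hc n
  have hrec : ∀ w n, coordAlpha ξ (alpha ξ ^ (n + 2) * w) =
      coordAlpha ξ (alpha ξ ^ (n + 1) * w) - ratio ξ * coordAlpha ξ (alpha ξ ^ n * w) := by
    intro w n
    simp only [pow_succ', mul_assoc, coordAlpha_alpha_mul h0 h1, coordOne_alpha_mul h0 h1]
    ring
  rcases hu with ⟨n, w, hw, rfl⟩ | hu | ⟨n, w, hw, rfl⟩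
  · -- `u` on the spiral around `0`
    rw [coordOne_pow_succ_mul h0 h1] at ha
    have b1 := (hbounds w hw (n + 1)).1
    have y1 := mul_nonneg hr0 (sub_nonneg.2 b1)
    -- The functional `o + (1-r)a` takes the value `b (n+4) < kc` at `f₁ u`. It is at least `kc` on
    -- `f₂(B)` and on `f₂f₂` of the spiral around `0`.
    have b4 := hfour w hw (n + 4) (by omega)
    have e0 := hrec w n
    have e1 := hrec w (n + 1)
    have e2 := hrec w (n + 2)
    simp only [add_assoc, Nat.reduceAdd] at e0 e1 e2
    rcases hv with ⟨m, w', hw', rfl⟩ | hv | ⟨m, w', hw', rfl⟩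
    · rw [coordOne_pow_succ_mul h0 h1] at ho
      have d := ((spiralSequence_of_mem h0 h1 hr hw').sub_bounds (by linarith) (by linarith) hc m).2
      have y2 := mul_nonneg hr0 (sub_nonneg.2 d)
      linarith
    · obtain ⟨hA, -⟩ := (mem_B h0 h1 hr).1 hv
      obtain ⟨-, -, -, hs⟩ := (mem_A_zero h0 h1 hr).1 hA
      have y2 := mul_nonneg hr0 (sub_nonneg.2 hs)
      nlinarith
    · rw [coordOne_f₂ h0 h1, coordAlpha_f₂ h0 h1, coordOne_pow_succ_mul h0 h1] at ho
      rw [coordOne_f₂ h0 h1, coordOne_pow_succ_mul h0 h1] at ha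
      have y2 := mul_nonneg hr0 (mul_nonneg hr0 (sub_nonneg.2 (hbounds w' hw' (m + 1)).1))
      nlinarith
  · -- `u` in the pentagon
    obtain ⟨hA, hcut⟩ := (mem_B h0 h1 hr).1 hu
    obtain ⟨hp, hq, hl, hs⟩ := (mem_A_zero h0 h1 hr).1 hA
    have y1 := mul_nonneg hr0 hq
    rcases hv with ⟨m, w', hw', rfl⟩ | hv | ⟨m, w', hw', rfl⟩
    · rw [coordOne_pow_succ_mul h0 h1] at ho
      have d := ((spiralSequence_of_mem h0 h1 hr hw').sub_bounds (by linarith) (by linarith) hc m).2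
      have y2 := mul_nonneg hr0 (sub_nonneg.2 d)
      nlinarith
    · obtain ⟨hA', hcut'⟩ := (mem_B h0 h1 hr).1 hv
      obtain ⟨hp', hq', -, -⟩ := (mem_A_zero h0 h1 hr).1 hA'
      -- By the cut, `coordOne` is at least `rkc > 0` at `f₂ v`, whereas it is nonpositive at `f₁
      -- u`.
      have y2 : 0 ≤ (1 - 2 * ratio ξ) * coordAlpha ξ v := mul_nonneg (by linarith) hq'
      linarith
    · rw [coordOne_f₂ h0 h1, coordAlpha_f₂ h0 h1, coordOne_pow_succ_mul h0 h1] at ho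
      rw [coordOne_f₂ h0 h1, coordOne_pow_succ_mul h0 h1] at ha
      -- Compare `o + a`: it is `1 + r² b m` at `f₂ v`, and at most `1 - rkc` at `f₁ u` by the cut.
      have y2 := mul_pos (mul_pos (show 0 < ratio ξ by linarith) (show 0 < ratio ξ by linarith))
        (sub_pos.2 (hlower w' hw' m))
      have y3 : 0 < ratio ξ * ((1 - ratio ξ - ratio ξ ^ 2) * (1 / (1 - ratio ξ ^ 2))) *
        (1 - ratio ξ ^ 2) := mul_pos hrkc hd
      linarith
  · -- `u` on the spiral around `1`
    have e0 := hrec w n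
    have e1 := hrec w (n + 1)
    have e2 := hrec w (n + 2)
    simp only [add_assoc, Nat.reduceAdd] at e0 e1 e2
    rw [coordAlpha_f₂ h0 h1, coordOne_pow_succ_mul h0 h1] at ho
    rw [coordAlpha_f₂ h0 h1, coordOne_f₂ h0 h1, coordOne_pow_succ_mul h0 h1] at ha
    rcases hv with ⟨m, w', hw', rfl⟩ | hv | ⟨m, w', hw', rfl⟩
    · rw [coordOne_pow_succ_mul h0 h1] at ho
      have d := ((spiralSequence_of_mem h0 h1 hr hw').sub_bounds (by linarith) (by linarith) hc m).2
      have y2 := mul_nonneg hr0 (sub_nonneg.2 d)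
      have y1 := mul_nonneg hr0 (mul_nonneg hr0 (sub_nonneg.2 (hbounds w hw n).2))
      nlinarith
    · obtain ⟨hA', hcut'⟩ := (mem_B h0 h1 hr).1 hv
      obtain ⟨hp', hq', -, -⟩ := (mem_A_zero h0 h1 hr).1 hA'
      have l := hlower w hw (n + 4)
      -- The equation forces `v = (1 - r b (n+1), b (n+2))`. There the cut of `B` reads `b (n+4) ≤
      -- -rkc`, which `neg_lt` excludes; this is the sharp case.
      have hB : ratio ξ * (coordAlpha ξ v - coordAlpha ξ (alpha ξ ^ (n + 2) * w)) = 0 := by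
        rw [e0]; linarith
      have hB' := (mul_eq_zero.1 hB).resolve_left (by linarith)
      have : coordAlpha ξ v = coordAlpha ξ (alpha ξ ^ (n + 2) * w) := by linarith
      rw [this] at hcut'
      nlinarith
    · have hα := alpha_sq h0 h1
      have hr' : (ratio ξ : ℂ) ≠ 0 := Complex.ofReal_ne_zero.2 (by linarith)
      -- Both spirals are centred at `α`: `f₁f₂(z) = α - rz` and `f₂f₂(z) = α + ᾱ²z`. Equating them,
      -- multiplying by `α²` and dividing by `r` gives this relation.
      have key : alpha ξ ^ (n + 3) * w = ((-ratio ξ : ℝ) : ℂ) * (alpha ξ ^ (m + 1) * w') := by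
        apply mul_left_cancel₀ hr'
        simp only [f₁, f₂_eq h0 h1] at huv
        push_cast at huv ⊢
        rw [show n + 3 = n + 1 + 2 from rfl, pow_add _ (n + 1) 2]
        generalize alpha ξ ^ (n + 1) = U at *
        generalize alpha ξ ^ (m + 1) = V at *
        linear_combination alpha ξ ^ 2 * huv + (V * w' * (2 * ratio ξ -
          (alpha ξ ^ 2 - alpha ξ + ratio ξ)) + alpha ξ ^ 2 * U * w) * hα
      -- Cancelling the smaller power of `α` leaves a point of `A₀` on one side. One further factor
      -- `α` makes its coordinate `b 1 ≥ kc`, which is incompatible with `neg_lt` on the other side.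
      rcases le_total m (n + 2) with hmn | hmn
      · obtain ⟨j, hj⟩ := Nat.exists_eq_add_of_le hmn
        have : alpha ξ ^ j * w = ((-ratio ξ : ℝ) : ℂ) * w' := by
          apply mul_left_cancel₀ (pow_ne_zero (m + 1) (alpha_ne_zero h0 h1))
          rw [show n + 3 = m + 1 + j by omega, pow_add] at key
          linear_combination key
        have h2 : coordAlpha ξ (alpha ξ ^ (j + 1) * w) =
            -ratio ξ * coordAlpha ξ (alpha ξ ^ 1 * w') := by
          rw [pow_succ', mul_assoc, this, ← coordAlpha_ofReal_mul]
          congr 1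
          ring
        have l := hlower w hw (j + 1)
        have h3 := (spiralSequence_of_mem h0 h1 hr hw').one_lower
        have := mul_nonneg hr0 (sub_nonneg.2 h3)
        linarith
      · obtain ⟨j, hj⟩ := Nat.exists_eq_add_of_le hmn
        have : w = ((-ratio ξ : ℝ) : ℂ) * (alpha ξ ^ j * w') := by
          apply mul_left_cancel₀ (pow_ne_zero (n + 3) (alpha_ne_zero h0 h1))
          rw [show m + 1 = n + 3 + j by omega, pow_add] at key
          linear_combination key
        have h2 : coordAlpha ξ (alpha ξ ^ 1 * w) =
            -ratio ξ * coordAlpha ξ (alpha ξ ^ (j + 1) * w') := by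
          rw [this, ← coordAlpha_ofReal_mul]
          congr 1
          ring
        have l := hlower w' hw' (j + 1)
        have h3 := (spiralSequence_of_mem h0 h1 hr hw).one_lower
        nlinarith

/-! ### The open set condition -/

theorem openSetCondition_interior_C (h0 : 0 < ξ) (h1 : ξ < Real.pi / 4)
    (hr : Subcritical (ratio ξ)) : OpenSetCondition (f₁ ξ) (f₂ ξ) (interior (C ξ)) := by
  have hα := alpha_ne_zero h0 h1
  have ho1 : IsOpenMap (f₁ ξ) := (Homeomorph.mulLeft₀ _ hα).isOpenMap
  have ho2 : IsOpenMap (f₂ ξ) := by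
    have h : -(starRingEnd ℂ) (alpha ξ) ≠ 0 := neg_ne_zero.2 (by simpa using hα)
    exact ((Homeomorph.mulLeft₀ _ h).trans (Homeomorph.addRight 1)).isOpenMap
  have hsub := Set.union_subset_iff.1 (f₁_image_union_f₂_image_subset h0 h1 hr)
  refine ⟨isOpen_interior, ?_, Set.union_subset ?_ ?_, ?_⟩
  · have hlo := hr.quarter_lt
    have hhi := hr.lt
    have hd : 0 < 1 - ratio ξ ^ 2 := by nlinarith
    have hc : 0 < 1 / (1 - ratio ξ ^ 2) := by positivity
    have hcoord : Continuous (coordOne ξ) := continuous_coordOne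
    have hcoord' : Continuous (coordAlpha ξ) := continuous_coordAlpha
    set r := ratio ξ with hrdef
    set c := 1 / (1 - r ^ 2) with hcdef
    let V : Set ℂ := {z | coordOne ξ z < 0} ∩ {z | 0 < coordOne ξ z + r * coordAlpha ξ z} ∩
      ({z | (1 - r - r ^ 2) * c < coordAlpha ξ z} ∩ {z | coordAlpha ξ z < c})
    have hV : IsOpen V :=
      ((isOpen_lt hcoord continuous_const).inter
        (isOpen_lt continuous_const (hcoord.add (continuous_const.mul hcoord')))).inter
      ((isOpen_lt continuous_const hcoord').inter (isOpen_lt hcoord' continuous_const))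
    have hVC : V ⊆ C ξ := by
      rintro z ⟨⟨hz1, hz2⟩, hz3, hz4⟩
      rw [mem_C h0 h1]
      left
      refine ⟨0, (mem_A_natCast h0 h1).1 ?_⟩
      rw [zero_add, Nat.cast_one, A_one, mem_A₁ h0 h1 hr]
      exact ⟨le_of_lt hz1, le_of_lt hz2, le_of_lt hz3, le_of_lt hz4⟩
    -- A point strictly inside `A₁`: `y` lies between `kc` and `c`, and `coordOne` is taken halfway
    -- between `-ry` and `0`.
    let y : ℝ := (1 - r / 2) * c
    let z : ℂ := ((-(r * y / 2) : ℝ) : ℂ) + (y : ℂ) * alpha ξ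
    have hz : coordOne ξ z = -(r * y / 2) := by
      rw [coordOne_add, coordOne_ofReal, coordOne_ofReal_mul, coordOne_alpha h0 h1]; ring
    have hz' : coordAlpha ξ z = y := by
      rw [coordAlpha_add, coordAlpha_ofReal, coordAlpha_ofReal_mul, coordAlpha_alpha h0 h1]; ring
    have hy : 0 < y := mul_pos (by linarith) hc
    have hry : 0 < r * y := mul_pos (by linarith) hy
    refine ⟨z, interior_maximal hVC hV ⟨⟨?_, ?_⟩, ?_, ?_⟩⟩
    · rw [Set.mem_ofPred_eq, hz]; linarith
    · rw [Set.mem_ofPred_eq, hz, hz']; linarith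
    · rw [Set.mem_ofPred_eq, hz']
      exact mul_lt_mul_of_pos_right (by nlinarith) hc
    · rw [Set.mem_ofPred_eq, hz']
      exact mul_lt_of_lt_one_left hc (by linarith)
  · exact (ho1.image_interior_subset _).trans (interior_mono hsub.1)
  · exact (ho2.image_interior_subset _).trans (interior_mono hsub.2)
  · exact Set.subset_empty_iff.1 ((Set.inter_subset_inter (Set.image_mono interior_subset)
      (Set.image_mono interior_subset)).trans (f₁_image_inter_f₂_image_eq_empty h0 h1 hr).subset)

end DragonCurve

theorem proposition4 :
    ∃ x₀ ξ₀ : ℝ,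
      (√2 < x₀ ∧ x₀ < (1 + √5) / 2 ∧ x₀ ^ 6 - 3 * x₀ ^ 4 + 2 * x₀ ^ 2 - 1 = 0 ∧
        ξ₀ = Real.arccos (x₀ / 2)) ∧
      |ξ₀ - 0.703858| < 5 / 10 ^ 7 ∧ 0 < ξ₀ ∧ ξ₀ < Real.pi / 4 ∧
      ∀ ξ : ℝ, 0 < ξ → ξ < ξ₀ →
        DragonCurve.f₁ ξ '' DragonCurve.C ξ ∩ DragonCurve.f₂ ξ '' DragonCurve.C ξ = ∅ ∧
        DragonCurve.f₁ ξ '' DragonCurve.C ξ ∪ DragonCurve.f₂ ξ '' DragonCurve.C ξ ⊆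
          DragonCurve.C ξ ∧
        DragonCurve.OpenSetCondition (DragonCurve.f₁ ξ) (DragonCurve.f₂ ξ)
          (interior (DragonCurve.C ξ)) := by
  obtain ⟨x, _, ⟨h2, h5, hx, rfl⟩, hn, hpos, hpi⟩ := DragonCurve.exists_critical_parameter
  refine ⟨x, _, ⟨h2, h5, hx, rfl⟩, hn, hpos, hpi, fun ξ h0 hξ => ?_⟩
  have h1 := hξ.trans hpi
  have hr := DragonCurve.subcritical_of_lt_arccos h2 hx h0 hξ h1
  exact ⟨DragonCurve.f₁_image_inter_f₂_image_eq_empty h0 h1 hr,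
    DragonCurve.f₁_image_union_f₂_image_subset h0 h1 hr,
    DragonCurve.openSetCondition_interior_C h0 h1 hr⟩
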